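/- Conventions. For a measurable space $(\Omega,\Sigma)$ and a complex Hilbert space $\mathcal H$, an observable (POVM) is a map $\mathsf M:\Sigma\to\mathcal L(\mathcal H)$ such that $\mathsf M(X)\ge 0$ for all $X$, $\mathsf M(\Omega)=I_{\mathcal H}$, and $\mathsf M(\bigcup_j X_j)=\sum_j\mathsf M(X_j)$ weakly for pairwise disjoint $X_1,X_2,\ldots\in\Sigma$; for a measure $\mu$ on $\Sigma$, $\mathsf M\ll\mu$ means that $\mu(X)=0$ implies $\mathsf M(X)=0$. The space $(\Omega,\Sigma)$ is nice if it is countably generated and there is a map $f:\Omega\to\mathbb R$ such that $f^{-1}(Y)\in\Sigma$ for every Borel set $Y\subseteq\mathbb R$, every $X\in\Sigma$ is of the form $f^{-1}(Y)$ with $Y$ Borel, and $f(\Omega)$ is a Borel set. $\mathsf M$ is of rank 1 if there are a $\sigma$-finite measure $\mu$ with $\mathsf M\ll\mu$, a direct integral $\mathcal H_\oplus=\int_\Omega^\oplus\mathcal H(x)\,\mathrm d\mu(x)$ of separable Hilbert spaces, with canonical spectral measure $\mathsf P_\oplus$ ($\mathsf P_\oplus(X)$ is multiplication by the characteristic function of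 $X$), and a linear isometry $J:\mathcal H\to\mathcal H_\oplus$ such that $\mathsf M(X)=J^*\mathsf P_\oplus(X)J$ for all $X\in\Sigma$, the vectors $\mathsf P_\oplus(X)J\varphi$ ($X\in\Sigma$, $\varphi\in\mathcal H$) span a dense subspace of $\mathcal H_\oplus$, and $\dim\mathcal H(x)=1$ for $\mu$-almost all $x\in\Omega$. For a measure $\mu$ on $\Sigma_1$, a $\mu$-weak Markov kernel is a map $\beta:\Sigma_2\times\Omega_1\to\mathbb R$ such that for every $Y\in\Sigma_2$ the function $\beta(Y,\cdot)$ is $\mu$-measurable and $\beta(Y,x)\ge 0$ for $\mu$-a.a. $x$; $\beta(\Omega_2,x)=1$ for $\mu$-a.a. $x$; and for every pairwise disjoint sequence $Y_1,Y_2,\ldots\in\Sigma_2$ one has $\beta(\bigcup_jY_j,x)=\sum_j\beta(Y_j,x)$ for $\mu$-a.a. $x$ (the null sets may depend on $Y$, respectively on the sequence). An observable $\mathsf M_2:\Sigma_2\to\mathcal L(\mathcal H)$ is a post-processing of $\mathsf M_1:\Sigma_1\to\mathcal L(\mathcal H)$ if there are a $\sigma$-finite measure $\mu$ on $\Sigma_1$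 with $\mathsf M_1\ll\mu$ and a $\mu$-weak Markov kernel $\beta$ such that $\mathsf M_2(Y)=\int_{\Omega_1}\beta(Y,x)\,\mathrm d\mathsf M_1(x)$ weakly for all $Y\in\Sigma_2$. Corollary. Let $(\Omega_1,\Sigma_1)$ be a nice measurable space, $(\Omega_2,\Sigma_2)$ a countably generated measurable space, and $\mathcal H$ a separable complex Hilbert space. Let $\mathsf M_i:\Sigma_i\to\mathcal L(\mathcal H)$, $i=1,2$, be observables such that $\mathsf M_2$ is of rank 1. If $\mathsf M_2$ is a post-processing of $\mathsf M_1$, then $\mathsf M_1$ is of rank 1 as well. -/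

import Mathlib

open MeasureTheory Set
open scoped ENNReal InnerProductSpace

noncomputable section

namespace RankOnePOVM

/-- A measurable space is nice if it is countably generated and there is an exactly measurable
function `f : Ω → ℝ` (measurable, and every measurable set is the preimage of a Borel set)
whose range is a Borel set. -/
def IsNice (Ω : Type*) [MeasurableSpace Ω] : Prop :=
  MeasurableSpace.CountablyGenerated Ω ∧
    ∃ f : Ω → ℝ, Measurable f ∧
      (∀ X : Set Ω, MeasurableSet X → ∃ Y : Set ℝ, MeasurableSet Y ∧ f ⁻¹' Y = X) ∧
      MeasurableSet (range f)

/-- Normalized positive-operator-valued measures (observables). Only the values on measurable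
sets matter; the additivity is in the weak operator sense. -/
structure POVM (Ω : Type*) [MeasurableSpace Ω] (H : Type*) [NormedAddCommGroup H]
    [InnerProductSpace ℂ H] where
  toFun : Set Ω → H →L[ℂ] H
  isPositive : ∀ X, MeasurableSet X → (toFun X).IsPositive
  map_univ : toFun univ = ContinuousLinearMap.id ℂ H
  hasSum_iUnion : ∀ X : ℕ → Set Ω, (∀ j, MeasurableSet (X j)) →
    Pairwise (Function.onFun Disjoint X) →
    ∀ φ ψ : H, HasSum (fun j => ⟪φ, toFun (X j) ψ⟫_ℂ) ⟪φ, toFun (⋃ j, X j) ψ⟫_ℂ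

namespace POVM

variable {Ω : Type*} [MeasurableSpace Ω] {H : Type*} [NormedAddCommGroup H]
  [InnerProductSpace ℂ H]

instance : CoeFun (POVM Ω H) (fun _ => Set Ω → H →L[ℂ] H) := ⟨toFun⟩

/-- The finite scalar measure `X ↦ ⟨φ | M(X) φ⟩`. -/
def diagMeasure (M : POVM Ω H) (φ : H) : Measure Ω :=
  Measure.ofMeasurable (fun X _ => ENNReal.ofReal (⟪φ, M X φ⟫_ℂ).re)
    (by
      have h := M.hasSum_iUnion (fun _ => ∅) (fun _ => MeasurableSet.empty)
        (fun _ _ _ => by simp [Function.onFun]) φ φ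
      have h0 := (summable_const_iff _).1 h.summable
      rw [h0]
      simp)
    (by
      intro X hX hd
      have h := M.hasSum_iUnion X hX hd φ φ
      have hre := Complex.hasSum_re h
      have hnn : ∀ j, 0 ≤ (⟪φ, M (X j) φ⟫_ℂ).re := fun j =>
        (M.isPositive _ (hX j)).re_inner_nonneg_right φ
      rw [← hre.tsum_eq]
      exact ENNReal.ofReal_tsum_of_nonneg hnn hre.summable)

/-- `M ≪ μ` -/
def AbsCont (M : POVM Ω H) (μ : Measure Ω) : Prop :=
  ∀ X, MeasurableSet X → μ X = 0 → M X = 0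

end POVM

/-- The infinite-dimensional separable Hilbert space `ℓ²(ℕ, ℂ)`, which contains all fibres. -/
abbrev L2Seq : Type := lp (fun _ : ℕ => ℂ) 2

/-- The `n`-dimensional fibre: the sequences supported on `{k | k < n}`. -/
def fibre (n : ℕ∞) : Submodule ℂ L2Seq where
  carrier := {v | ∀ k : ℕ, n ≤ (k : ℕ∞) → v k = 0}
  zero_mem' := by intro k _; simp
  add_mem' := by
    intro v w hv hw k hk
    simp [hv k hk, hw k hk]
  smul_mem' := by
    intro c v hv k hk
    simp [hv k hk]

variable {Ω : Type*} [MeasurableSpace Ω]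

/-- The direct integral `∫^⊕ H(x) dμ(x)` of the separable Hilbert spaces `H(x) = fibre (m x)`
of dimension `m x`: the (classes of) square integrable measurable sections. -/
def directIntegral (μ : Measure Ω) (m : Ω → ℕ∞) : Submodule ℂ (Lp L2Seq 2 μ) where
  carrier := {ψ | ∀ᵐ x ∂μ, ψ x ∈ fibre (m x)}
  zero_mem' := by
    filter_upwards [Lp.coeFn_zero L2Seq 2 μ] with x hx
    rw [hx]
    exact Submodule.zero_mem _
  add_mem' := by
    intro ψ η hψ hη
    filter_upwards [hψ, hη, Lp.coeFn_add ψ η] with x h1 h2 hx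
    rw [hx]
    exact Submodule.add_mem _ h1 h2
  smul_mem' := by
    intro c ψ hψ
    filter_upwards [hψ, Lp.coeFn_smul c ψ] with x h1 hx
    rw [hx]
    exact Submodule.smul_mem _ c h1

theorem isClosed_fibre (n : ℕ∞) : IsClosed (fibre n : Set L2Seq) := by
  have h : (fibre n : Set L2Seq) =
      ⋂ k : ℕ, ⋂ _ : n ≤ (k : ℕ∞), {v : L2Seq | v k = 0} := by
    ext v
    simp only [mem_iInter, mem_ofPred_eq]
    exact Iff.rfl
  rw [h]
  refine isClosed_iInter fun k => isClosed_iInter fun _ => isClosed_eq ?_ continuous_const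
  exact (lp.evalCLM ℂ (fun _ : ℕ => ℂ) 2 k).continuous

theorem isClosed_directIntegral (μ : Measure Ω) (m : Ω → ℕ∞) :
    IsClosed (directIntegral μ m : Set (Lp L2Seq 2 μ)) := by
  refine IsSeqClosed.isClosed fun u ψ hu hψ => ?_
  obtain ⟨ns, -, hns⟩ := (tendstoInMeasure_of_tendsto_Lp hψ).exists_seq_tendsto_ae
  have hall : ∀ᵐ x ∂μ, ∀ i, u (ns i) x ∈ fibre (m x) := ae_all_iff.2 fun i => hu (ns i)
  change ∀ᵐ x ∂μ, ψ x ∈ fibre (m x)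
  filter_upwards [hns, hall] with x h1 h2
  exact (isClosed_fibre (m x)).mem_of_tendsto h1 (Filter.Eventually.of_forall h2)

instance (μ : Measure Ω) (m : Ω → ℕ∞) : CompleteSpace (directIntegral μ m) :=
  (isClosed_directIntegral μ m).completeSpace_coe

/-- Multiplication by the characteristic function of `X` on `L²(μ; ℓ²)`. -/
def indicatorLp (μ : Measure Ω) (X : Set Ω) (hX : MeasurableSet X) :
    Lp L2Seq 2 μ →L[ℂ] Lp L2Seq 2 μ :=
  LinearMap.mkContinuous
    { toFun := fun ψ => ((Lp.memLp ψ).indicator hX).toLp _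
      map_add' := by
        intro ψ η
        rw [← MemLp.toLp_add, MemLp.toLp_eq_toLp_iff]
        filter_upwards [Lp.coeFn_add ψ η] with x h
        by_cases hxX : x ∈ X
        · simp only [indicator_of_mem hxX, Pi.add_apply]
          exact h
        · simp [hxX]
      map_smul' := by
        intro c ψ
        rw [RingHom.id_apply, ← MemLp.toLp_const_smul, MemLp.toLp_eq_toLp_iff]
        filter_upwards [Lp.coeFn_smul c ψ] with x h
        by_cases hxX : x ∈ X
        · simp only [indicator_of_mem hxX, Pi.smul_apply]
          exact h
        · simp [hxX] }
    1 (by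
      intro ψ
      rw [one_mul]
      refine Lp.norm_le_norm_of_ae_le ?_
      filter_upwards [((Lp.memLp ψ).indicator hX).coeFn_toLp] with x hx
      refine (le_of_eq (congrArg norm hx)).trans ?_
      exact norm_indicator_le_norm_self _ _)

theorem coeFn_indicatorLp (μ : Measure Ω) (X : Set Ω) (hX : MeasurableSet X)
    (ψ : Lp L2Seq 2 μ) : indicatorLp μ X hX ψ =ᵐ[μ] X.indicator ψ :=
  ((Lp.memLp ψ).indicator hX).coeFn_toLp

theorem indicatorLp_mem (μ : Measure Ω) (m : Ω → ℕ∞) (X : Set Ω) (hX : MeasurableSet X)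
    (ψ : directIntegral μ m) :
    indicatorLp μ X hX (ψ : Lp L2Seq 2 μ) ∈ directIntegral μ m := by
  change ∀ᵐ x ∂μ, _
  filter_upwards [coeFn_indicatorLp μ X hX (ψ : Lp L2Seq 2 μ), ψ.2] with x hx h
  rw [hx]
  by_cases hxX : x ∈ X
  · simpa [hxX] using h
  · simp [hxX]

/-- The canonical spectral measure on the direct integral: multiplication by the characteristic
function of `X`. -/
def canonicalPVM (μ : Measure Ω) (m : Ω → ℕ∞) (X : Set Ω) (hX : MeasurableSet X) :
    directIntegral μ m →L[ℂ] directIntegral μ m :=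
  ((indicatorLp μ X hX).comp (directIntegral μ m).subtypeL).codRestrict (directIntegral μ m)
    (indicatorLp_mem μ m X hX)

variable {H : Type*} [NormedAddCommGroup H] [InnerProductSpace ℂ H] [CompleteSpace H]

/-- The isometry `J : H → ∫^⊕ H(x) dμ(x)` together with the canonical spectral measure `P` is a
minimal Naimark dilation of `M`: one has `M(X) = J* P(X) J`, and the vectors `P(X) J φ` span a
dense subspace. -/
structure IsMinimalNaimarkDilation (M : POVM Ω H) (μ : Measure Ω) (m : Ω → ℕ∞)
    (J : H →ₗᵢ[ℂ] directIntegral μ m) : Prop where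
  eq_compression : ∀ X (hX : MeasurableSet X),
    M X = (ContinuousLinearMap.adjoint J.toContinuousLinearMap).comp
      ((canonicalPVM μ m X hX).comp J.toContinuousLinearMap)
  dense_span : Dense (Submodule.span ℂ
    {η | ∃ (X : Set Ω) (hX : MeasurableSet X) (φ : H), η = canonicalPVM μ m X hX (J φ)} :
      Set (directIntegral μ m))

/-- `M` is of rank 1: for some σ-finite `μ` with `M ≪ μ`, it has a minimal Naimark dilation on a
direct integral over `μ` whose fibres are one-dimensional `μ`-almost everywhere. -/
def IsRankOne (M : POVM Ω H) : Prop :=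
  ∃ μ : Measure Ω, SigmaFinite μ ∧ M.AbsCont μ ∧
    ∃ m : Ω → ℕ∞, Measurable m ∧
      (∃ J : H →ₗᵢ[ℂ] directIntegral μ m, IsMinimalNaimarkDilation M μ m J) ∧
      ∀ᵐ x ∂μ, m x = 1

variable {Ω₁ Ω₂ : Type*} [MeasurableSpace Ω₁] [MeasurableSpace Ω₂]

/-- A `μ`-weak Markov kernel `β : Σ₂ × Ω₁ → ℝ` (only the values on measurable sets matter).
The exceptional null sets may depend on the sets `Y` and on the sequences. -/
structure IsWeakMarkovKernel (μ : Measure Ω₁) (β : Set Ω₂ → Ω₁ → ℝ) : Prop where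
  aemeasurable : ∀ Y, MeasurableSet Y → AEMeasurable (β Y) μ
  nonneg : ∀ Y, MeasurableSet Y → ∀ᵐ x ∂μ, 0 ≤ β Y x
  univ_eq_one : ∀ᵐ x ∂μ, β univ x = 1
  hasSum_iUnion : ∀ Y : ℕ → Set Ω₂, (∀ j, MeasurableSet (Y j)) →
    Pairwise (Function.onFun Disjoint Y) →
    ∀ᵐ x ∂μ, HasSum (fun j => β (Y j) x) (β (⋃ j, Y j) x)

/-- `M₂` is a post-processing of `M₁`: there are a measure `μ` with `M₁ ≪ μ` and a `μ`-weak
Markov kernel `β` with `M₂(Y) = ∫ β(Y, x) dM₁(x)` weakly. By polarization it is enough to test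
the weak integral on the diagonal; the integrands are bounded almost everywhere. -/
def IsPostProcessing (M₂ : POVM Ω₂ H) (M₁ : POVM Ω₁ H) : Prop :=
  ∃ μ : Measure Ω₁, SigmaFinite μ ∧ M₁.AbsCont μ ∧
    ∃ β : Set Ω₂ → Ω₁ → ℝ, IsWeakMarkovKernel μ β ∧
      ∀ Y, MeasurableSet Y → ∀ φ : H,
        ⟪φ, M₂ Y φ⟫_ℂ = ((∫ x, β Y x ∂(M₁.diagMeasure φ) : ℝ) : ℂ)

end RankOnePOVM

end

/-! Write `k φ ψ` for the density of `X ↦ ⟨φ | M₁(X) ψ⟩` with respect to a finite measure equivalent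
to `M₁`. Almost everywhere it behaves like a positive sesquilinear form, and rank 1 follows once
this form has rank one, that is, once `|k φ ψ|² = k φ φ · k ψ ψ` a.e. for each pair `φ, ψ`.

Rank 1 of `M₂` supplies scalar sections `g φ` with `⟨φ | M₂(Y) φ⟩ = ∫_Y |g φ|² dν`. At each outcome
`y` some unit vector `(a, b)` nearly annihilates `(g φ y, g ψ y)`. Taking such vectors from a
countable net, partition `Ω₂` into sets `Yₙ` on which `χₙ = aₙ φ + bₙ ψ` has `|g χₙ|² ≤ ε (|g φ|² +
|g ψ|²)`. Then `∑ ⟨χₙ | M₂(Yₙ) χₙ⟩ ≤ ε C`.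

The same sum equals `∑ ∫ β(Yₙ, x) k χₙ χₙ dμ`. Each `k χₙ χₙ` dominates determinant over trace of
the `2 × 2` Gram matrix of `φ, ψ`, a lower bound for its smallest eigenvalue, and `∑ β(Yₙ, x) = 1`.
So the integral of this quotient is at most `ε C` for every `ε`, and the determinant vanishes a.e.
(`POVM.IsDensity.norm_sq_eq`). Only countable partitions occur, so a weak kernel suffices.

Conversely, a rank-one form is `|f φ|²` with `f` linear in `φ`; this `f` is the isometry into a
direct integral with one-dimensional fibres (`POVM.IsDensity.isRankOne`). -/

noncomputable section

namespace RankOnePOVM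

/-! ### Linear algebra of hermitian forms on `ℂ²` -/

section


/-- Every vector of `ℂ²` is annihilated by some unit functional; by density a fixed countable family
of unit functionals does so up to `ε`. Countability makes the resulting cover of the outcome space a
sequence. -/
theorem exists_unit_net : ∃ u : ℕ → ℂ × ℂ, (∀ n, ‖(u n).1‖ ^ 2 + ‖(u n).2‖ ^ 2 = 1) ∧
    ∀ ε > (0 : ℝ), ∀ z w : ℂ, ∃ n,
      ‖(u n).1 * z + (u n).2 * w‖ ^ 2 ≤ ε * (‖z‖ ^ 2 + ‖w‖ ^ 2) := by
  let S := Metric.sphere (0 : EuclideanSpace ℂ (Fin 2)) 1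
  have hS : ∀ v : EuclideanSpace ℂ (Fin 2), v ∈ S ↔ ‖v 0‖ ^ 2 + ‖v 1‖ ^ 2 = 1 := by
    intro v
    rw [mem_sphere_zero_iff_norm, ← sq_eq_sq₀ (norm_nonneg _) zero_le_one,
      EuclideanSpace.norm_sq_eq, Fin.sum_univ_two, one_pow]
  have e0 : !₂[(1 : ℂ), 0] ∈ S := by rw [hS]; simp
  have : Nonempty S := ⟨⟨_, e0⟩⟩
  refine ⟨fun n => ((TopologicalSpace.denseSeq S n : EuclideanSpace ℂ (Fin 2)) 0,
    (TopologicalSpace.denseSeq S n : EuclideanSpace ℂ (Fin 2)) 1), fun n => (hS _).1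
    (TopologicalSpace.denseSeq S n).2, ?_⟩
  intro ε hε z w
  rcases eq_or_ne (‖z‖ ^ 2 + ‖w‖ ^ 2) 0 with h0 | h0
  · have hz : z = 0 := by
      have : ‖z‖ ^ 2 = 0 := by nlinarith [sq_nonneg ‖z‖, sq_nonneg ‖w‖]
      simpa using this
    have hw : w = 0 := by
      have : ‖w‖ ^ 2 = 0 := by nlinarith [sq_nonneg ‖z‖, sq_nonneg ‖w‖]
      simpa using this
    exact ⟨0, by simp [hz, hw]⟩
  · have hpos : 0 < ‖z‖ ^ 2 + ‖w‖ ^ 2 := lt_of_le_of_ne (by positivity) h0.symm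
    set r := Real.sqrt (‖z‖ ^ 2 + ‖w‖ ^ 2)
    have hr2 : r ^ 2 = ‖z‖ ^ 2 + ‖w‖ ^ 2 := Real.sq_sqrt hpos.le
    have hr : 0 < r := Real.sqrt_pos.2 hpos
    let U : Set S := {v | ‖v.1 0 * z + v.1 1 * w‖ ^ 2 < ε * (‖z‖ ^ 2 + ‖w‖ ^ 2)}
    have hU : IsOpen U := isOpen_lt (by fun_prop) continuous_const
    -- The unit functional that annihilates `(z, w)` exactly.
    have hv : !₂[w / r, -z / r] ∈ S := by
      rw [hS]
      simp only [Matrix.cons_val_zero, Matrix.cons_val_one, norm_div, norm_neg,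
        Complex.norm_real, Real.norm_eq_abs, div_pow, sq_abs, hr2]
      field_simp
      ring
    have hne : U.Nonempty := by
      refine ⟨⟨_, hv⟩, ?_⟩
      have h1 : w / r * z + -z / r * w = 0 := by ring
      change ‖w / r * z + -z / r * w‖ ^ 2 < _
      rw [h1]
      simpa using mul_pos hε hpos
    obtain ⟨n, hn⟩ := (TopologicalSpace.denseRange_denseSeq S).exists_mem_open hU hne
    exact ⟨n, le_of_lt hn⟩

/-- Cayley–Hamilton bound: the determinant of a hermitian `2 × 2` matrix is at most its trace
times the quadratic form at a unit vector. -/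
theorem det_le_trace_mul (p r : ℝ) (q a b : ℂ) (hab : ‖a‖ ^ 2 + ‖b‖ ^ 2 = 1) :
    p * r - ‖q‖ ^ 2 ≤ (p + r) *
      (‖a‖ ^ 2 * p + 2 * (starRingEnd ℂ a * b * q).re + ‖b‖ ^ 2 * r) := by
  have h1 := sq_nonneg ‖a * p + b * q‖
  have h2 := sq_nonneg ‖a * starRingEnd ℂ q + b * r‖
  -- With `A` the matrix and `v = (a, b)`, this is `tr A ⟨v, Av⟩ - det A ‖v‖² = ‖Av‖²`.
  have h3 : (p + r) * (‖a‖ ^ 2 * p + 2 * (starRingEnd ℂ a * b * q).re + ‖b‖ ^ 2 * r)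
      - (‖a‖ ^ 2 + ‖b‖ ^ 2) * (p * r - ‖q‖ ^ 2)
      = ‖a * p + b * q‖ ^ 2 + ‖a * starRingEnd ℂ q + b * r‖ ^ 2 := by
    simp only [← Complex.normSq_eq_norm_sq, Complex.normSq_apply]
    simp
    ring
  rw [hab] at h3
  linarith

/-- A hermitian `2 × 2` matrix with nonnegative quadratic form has nonnegative determinant. -/
theorem norm_sq_le_of_quadratic_nonneg (p r : ℝ) (q : ℂ)
    (h : ∀ a b : ℂ, 0 ≤ ‖a‖ ^ 2 * p + 2 * (starRingEnd ℂ a * b * q).re + ‖b‖ ^ 2 * r) :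
    ‖q‖ ^ 2 ≤ p * r := by
  have hp := h 1 0
  have hr := h 0 1
  simp at hp hr
  -- The first two test vectors give `p (p r - |q|²) ≥ 0` and `r (p r - |q|²) ≥ 0`; the third
  -- settles `p = r = 0`, where it reads `-2 |q|² ≥ 0`.
  have h1 := h (-q) p
  have h2 := h (-r) (starRingEnd ℂ q)
  have h3 := h (-q) 1
  simp only [← Complex.normSq_eq_norm_sq, Complex.normSq_apply] at h1 h2 h3 ⊢
  simp at h1 h2 h3
  rcases hp.eq_or_lt with rfl | hp
  · rcases hr.eq_or_lt with rfl | hr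
    · nlinarith
    · by_contra hc
      push Not at hc
      nlinarith [mul_pos hr (sub_pos.2 hc)]
  · by_contra hc
    push Not at hc
    nlinarith [mul_pos hp (sub_pos.2 hc)]

end

/-! ### Scalar measures and densities of an observable -/

section


namespace POVM

variable {Ω : Type*} [MeasurableSpace Ω] {H : Type*} [NormedAddCommGroup H]
  [InnerProductSpace ℂ H]

theorem inner_right_eq_re (M : POVM Ω H) {X : Set Ω} (hX : MeasurableSet X) (φ : H) :
    ⟪φ, M X φ⟫_ℂ = ((⟪φ, M X φ⟫_ℂ).re : ℂ) :=
  ((M.isPositive X hX).isSymmetric.coe_re_inner_self_apply φ).symm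

theorem inner_right_re_nonneg (M : POVM Ω H) {X : Set Ω} (hX : MeasurableSet X) (φ : H) :
    0 ≤ (⟪φ, M X φ⟫_ℂ).re :=
  (M.isPositive X hX).re_inner_nonneg_right φ

theorem diagMeasure_apply (M : POVM Ω H) {X : Set Ω} (hX : MeasurableSet X) (φ : H) :
    M.diagMeasure φ X = ENNReal.ofReal (⟪φ, M X φ⟫_ℂ).re :=
  Measure.ofMeasurable_apply X hX

instance (M : POVM Ω H) (φ : H) : IsFiniteMeasure (M.diagMeasure φ) :=
  ⟨by rw [M.diagMeasure_apply MeasurableSet.univ]; exact ENNReal.ofReal_lt_top⟩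

theorem inner_right_eq_diagMeasure_real (M : POVM Ω H) {X : Set Ω} (hX : MeasurableSet X)
    (φ : H) : ⟪φ, M X φ⟫_ℂ = ((M.diagMeasure φ).real X : ℂ) := by
  rw [M.inner_right_eq_re hX, measureReal_def, M.diagMeasure_apply hX,
    ENNReal.toReal_ofReal (M.inner_right_re_nonneg hX φ)]

/-- Polarization. -/
theorem inner_right_eq_diagMeasure (M : POVM Ω H) {X : Set Ω} (hX : MeasurableSet X)
    (φ ψ : H) : ⟪φ, M X ψ⟫_ℂ =
      (((M.diagMeasure (φ + ψ)).real X : ℂ) - ((M.diagMeasure (φ - ψ)).real X : ℂ)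
        - Complex.I * ((M.diagMeasure (φ + Complex.I • ψ)).real X : ℂ)
        + Complex.I * ((M.diagMeasure (φ - Complex.I • ψ)).real X : ℂ)) / 4 := by
  have hsymm : ∀ v w : H, ⟪M X v, w⟫_ℂ = ⟪v, M X w⟫_ℂ := (M.isPositive X hX).isSymmetric
  have h := inner_map_polarization' (M X : H →ₗ[ℂ] H) φ ψ
  simp only [ContinuousLinearMap.coe_coe, hsymm] at h
  rw [h]
  simp only [M.inner_right_eq_diagMeasure_real hX]

theorem eq_zero_of_diagMeasure (M : POVM Ω H) {X : Set Ω} (hX : MeasurableSet X)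
    (h : ∀ φ, M.diagMeasure φ X = 0) : M X = 0 := by
  ext φ
  have h2 : ⟪M X φ, M X φ⟫_ℂ = 0 := by
    rw [M.inner_right_eq_diagMeasure hX]
    simp [measureReal_def, h]
  simpa using h2

theorem AbsCont.diagMeasure {M : POVM Ω H} {μ : Measure Ω} (h : M.AbsCont μ) (φ : H) :
    M.diagMeasure φ ≪ μ := by
  refine Measure.AbsolutelyContinuous.mk fun X hX h0 => ?_
  rw [M.diagMeasure_apply hX, h X hX h0]
  simp

/-- A finite measure equivalent to the observable. -/
def refMeasure [TopologicalSpace.SeparableSpace H] (M : POVM Ω H) : Measure Ω :=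
  (Measure.sum fun n => M.diagMeasure (TopologicalSpace.denseSeq H n)).toFinite

section refMeasure

variable [TopologicalSpace.SeparableSpace H] (M : POVM Ω H)

instance : IsFiniteMeasure M.refMeasure := by unfold refMeasure; infer_instance

theorem refMeasure_absolutelyContinuous_sum :
    M.refMeasure ≪ Measure.sum fun n => M.diagMeasure (TopologicalSpace.denseSeq H n) :=
  toFinite_absolutelyContinuous _

theorem refMeasure_absolutelyContinuous {μ : Measure Ω} (h : M.AbsCont μ) : M.refMeasure ≪ μ :=
  M.refMeasure_absolutelyContinuous_sum.trans
    (Measure.absolutelyContinuous_sum_left fun _ => h.diagMeasure _)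

/-- A null set is null for the diagonal measures of a dense sequence; continuity of the quadratic
form extends this to all vectors, and polarization gives `M X = 0`. -/
theorem absCont_refMeasure : M.AbsCont M.refMeasure := by
  intro X hX h0
  have h1 := absolutelyContinuous_toFinite _ h0
  rw [Measure.sum_apply _ hX, ENNReal.tsum_eq_zero] at h1
  have h2 : ∀ φ, (⟪φ, M X φ⟫_ℂ).re = 0 := by
    have hcl : IsClosed {φ : H | (⟪φ, M X φ⟫_ℂ).re = 0} :=
      isClosed_eq (by fun_prop) continuous_const
    have hsub : range (TopologicalSpace.denseSeq H) ⊆ {φ : H | (⟪φ, M X φ⟫_ℂ).re = 0} := by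
      rintro _ ⟨n, rfl⟩
      have h3 := h1 n
      rw [M.diagMeasure_apply hX, ENNReal.ofReal_eq_zero] at h3
      exact le_antisymm h3 (M.inner_right_re_nonneg hX _)
    intro φ
    exact hcl.closure_subset_iff.2 hsub (TopologicalSpace.denseRange_denseSeq H φ)
  refine M.eq_zero_of_diagMeasure hX fun φ => ?_
  rw [M.diagMeasure_apply hX, h2 φ, ENNReal.ofReal_zero]

end refMeasure

/-- `k φ ψ` is a density with respect to `μ` of the complex measure `X ↦ ⟨φ | M(X) ψ⟩`. -/
structure IsDensity (M : POVM Ω H) (μ : Measure Ω) (k : H → H → Ω → ℂ) : Prop where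
  measurable : ∀ φ ψ, Measurable (k φ ψ)
  integrable : ∀ φ ψ, Integrable (k φ ψ) μ
  setIntegral : ∀ φ ψ X, MeasurableSet X → ∫ x in X, k φ ψ x ∂μ = ⟪φ, M X ψ⟫_ℂ

/-- The densities are polarized from the Radon–Nikodym derivatives of the diagonal measures. -/
theorem exists_isDensity (M : POVM Ω H) (μ : Measure Ω) [SigmaFinite μ] (h : M.AbsCont μ) :
    ∃ k, M.IsDensity μ k := by
  let d : H → Ω → ℂ := fun φ x => (((M.diagMeasure φ).rnDeriv μ x).toReal : ℂ)
  have hd : ∀ φ, Integrable (d φ) μ := fun φ => Measure.integrable_toReal_rnDeriv.ofReal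
  have hdm : ∀ φ, Measurable (d φ) := fun φ =>
    Complex.measurable_ofReal.comp (Measure.measurable_rnDeriv _ _).ennreal_toReal
  have hds : ∀ φ X, ∫ x in X, d φ x ∂μ = ((M.diagMeasure φ).real X : ℂ) := by
    intro φ X
    rw [← Measure.setIntegral_toReal_rnDeriv (h.diagMeasure φ) X]
    exact integral_ofReal
  refine ⟨fun φ ψ x => (d (φ + ψ) x - d (φ - ψ) x - Complex.I * d (φ + Complex.I • ψ) x
    + Complex.I * d (φ - Complex.I • ψ) x) / 4, ?_, ?_, ?_⟩
  · intro φ ψ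
    have := hdm (φ + ψ)
    have := hdm (φ - ψ)
    have := hdm (φ + Complex.I • ψ)
    have := hdm (φ - Complex.I • ψ)
    fun_prop
  · intro φ ψ
    exact ((((hd _).sub (hd _)).sub ((hd _).const_mul _)).add ((hd _).const_mul _)).div_const _
  · intro φ ψ X hX
    have h1 := (hd (φ + ψ)).integrableOn (s := X)
    have h2 := (hd (φ - ψ)).integrableOn (s := X)
    have h3 := ((hd (φ + Complex.I • ψ)).const_mul Complex.I).integrableOn (s := X)
    have h4 := ((hd (φ - Complex.I • ψ)).const_mul Complex.I).integrableOn (s := X)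
    rw [integral_div, integral_add (by exact (h1.sub h2).sub h3) h4,
      integral_sub (by exact h1.sub h2) h3, integral_sub h1 h2, integral_const_mul, integral_const_mul, hds, hds, hds, hds,
      M.inner_right_eq_diagMeasure hX]

namespace IsDensity

variable {M : POVM Ω H} {μ : Measure Ω} {k : H → H → Ω → ℂ}

/-- Both sides have the same integral over every measurable set. The exceptional null set depends on
the vectors, so such identities may be combined only for countably many vectors at a time. -/
theorem add_right (hk : M.IsDensity μ k) (φ ψ χ : H) : ∀ᵐ x ∂μ, k φ (ψ + χ) x = k φ ψ x + k φ χ x := by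
  refine Integrable.ae_eq_of_forall_setIntegral_eq _ _ (hk.integrable _ _)
    ((hk.integrable _ _).add (hk.integrable _ _)) fun X hX _ => ?_
  rw [hk.setIntegral _ _ X hX]
  rw [integral_add (hk.integrable _ _).integrableOn (hk.integrable _ _).integrableOn,
    hk.setIntegral _ _ X hX, hk.setIntegral _ _ X hX, map_add, inner_add_right]

theorem smul_right (hk : M.IsDensity μ k) (c : ℂ) (φ ψ : H) : ∀ᵐ x ∂μ, k φ (c • ψ) x = c * k φ ψ x := by
  refine Integrable.ae_eq_of_forall_setIntegral_eq _ _ (hk.integrable _ _)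
    ((hk.integrable _ _).const_mul _) fun X hX _ => ?_
  rw [hk.setIntegral _ _ X hX, integral_const_mul, hk.setIntegral _ _ X hX, map_smul,
    inner_smul_right]

theorem conj_symm (hk : M.IsDensity μ k) (φ ψ : H) : ∀ᵐ x ∂μ, k ψ φ x = starRingEnd ℂ (k φ ψ x) := by
  refine Integrable.ae_eq_of_forall_setIntegral_eq _ _ (hk.integrable _ _)
    (Complex.conjCLE.toContinuousLinearMap.integrable_comp (hk.integrable φ ψ)) fun X hX _ => ?_
  rw [hk.setIntegral _ _ X hX, integral_conj, hk.setIntegral _ _ X hX, inner_conj_symm]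
  exact ((M.isPositive X hX).isSymmetric ψ φ).symm

theorem setIntegral_re (hk : M.IsDensity μ k) (φ : H) {X : Set Ω} (hX : MeasurableSet X) :
    ∫ x in X, (k φ φ x).re ∂μ = (⟪φ, M X φ⟫_ℂ).re := by
  rw [← hk.setIntegral _ _ X hX]
  exact integral_re (hk.integrable φ φ).integrableOn

theorem re_nonneg (hk : M.IsDensity μ k) (φ : H) : ∀ᵐ x ∂μ, 0 ≤ (k φ φ x).re := by
  refine ae_nonneg_of_forall_setIntegral_nonneg (hk.integrable φ φ).re fun X hX _ => ?_
  exact (M.inner_right_re_nonneg hX φ).trans_eq (hk.setIntegral_re φ hX).symm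

theorem ofReal_re (hk : M.IsDensity μ k) (φ : H) : ∀ᵐ x ∂μ, ((k φ φ x).re : ℂ) = k φ φ x := by
  filter_upwards [hk.conj_symm φ φ] with x hx
  exact (Complex.conj_eq_iff_re.1 hx.symm)

theorem diagMeasure_eq (hk : M.IsDensity μ k) (φ : H) :
    M.diagMeasure φ = μ.withDensity fun x => ENNReal.ofReal (k φ φ x).re := by
  ext X hX
  rw [withDensity_apply _ hX, M.diagMeasure_apply hX, ← hk.setIntegral_re φ hX]
  exact ofReal_integral_eq_lintegral_ofReal (hk.integrable φ φ).re.integrableOn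
    (ae_restrict_of_ae (hk.re_nonneg φ))

/-- The quadratic form of the density on a two-dimensional space. -/
theorem re_comb (hk : M.IsDensity μ k) (a b : ℂ) (φ ψ : H) : ∀ᵐ x ∂μ,
    (k (a • φ + b • ψ) (a • φ + b • ψ) x).re = ‖a‖ ^ 2 * (k φ φ x).re
      + 2 * (starRingEnd ℂ a * b * k φ ψ x).re + ‖b‖ ^ 2 * (k ψ ψ x).re := by
  set χ := a • φ + b • ψ
  -- The second argument is expanded by linearity; conjugate symmetry then moves `χ` from the first
  -- argument to the second.
  filter_upwards [hk.add_right χ (a • φ) (b • ψ), hk.smul_right a χ φ, hk.smul_right b χ ψ,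
    hk.conj_symm φ χ, hk.conj_symm ψ χ, hk.add_right φ (a • φ) (b • ψ), hk.smul_right a φ φ,
    hk.smul_right b φ ψ, hk.add_right ψ (a • φ) (b • ψ), hk.smul_right a ψ φ,
    hk.smul_right b ψ ψ, hk.conj_symm φ ψ, hk.ofReal_re φ, hk.ofReal_re ψ]
    with x h1 h2 h3 h4 h5 h6 h7 h8 h9 h10 h11 h12 h13 h14
  rw [h1, h2, h3, h4, h5, h6, h7, h8, h9, h10, h11, h12, ← h13, ← h14, ← Complex.normSq_eq_norm_sq,
    ← Complex.normSq_eq_norm_sq]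
  simp [Complex.normSq_apply]
  ring

end IsDensity

end POVM

end

section


/-! ### Scalar sections of a rank 1 dilation, and Cauchy–Schwarz for densities -/

section

variable {Ω : Type*} [MeasurableSpace Ω] {H : Type*} [NormedAddCommGroup H]
  [InnerProductSpace ℂ H]

theorem inner_canonicalPVM (μ : Measure Ω) (m : Ω → ℕ∞) (X : Set Ω) (hX : MeasurableSet X)
    (η ζ : directIntegral μ m) :
    ⟪η, canonicalPVM μ m X hX ζ⟫_ℂ
      = ∫ x in X, ⟪(η : Lp L2Seq 2 μ) x, (ζ : Lp L2Seq 2 μ) x⟫_ℂ ∂μ := by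
  change ⟪(η : Lp L2Seq 2 μ), indicatorLp μ X hX (ζ : Lp L2Seq 2 μ)⟫_ℂ = _
  rw [L2.inner_def, ← integral_indicator hX]
  refine integral_congr_ae ?_
  filter_upwards [coeFn_indicatorLp μ X hX (ζ : Lp L2Seq 2 μ)] with x hx
  rw [hx]
  by_cases hxX : x ∈ X <;> simp [hxX]

theorem inner_canonicalPVM_self_re (μ : Measure Ω) (m : Ω → ℕ∞) (X : Set Ω)
    (hX : MeasurableSet X) (η : directIntegral μ m) :
    ENNReal.ofReal (⟪η, canonicalPVM μ m X hX η⟫_ℂ).re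
      = ∫⁻ x in X, ENNReal.ofReal (‖(η : Lp L2Seq 2 μ) x‖ ^ 2) ∂μ := by
  have h1 : (⟪η, canonicalPVM μ m X hX η⟫_ℂ).re
      = ∫ x in X, ‖(η : Lp L2Seq 2 μ) x‖ ^ 2 ∂μ := by
    rw [inner_canonicalPVM, ← Complex.ofReal_re (∫ x in X, ‖(η : Lp L2Seq 2 μ) x‖ ^ 2 ∂μ)]
    congr 1
    rw [← integral_complex_ofReal]
    refine integral_congr_ae (Filter.Eventually.of_forall fun x => ?_)
    simp [inner_self_eq_norm_sq_to_K]
  rw [h1]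
  exact ofReal_integral_eq_lintegral_ofReal
    (Lp.memLp (η : Lp L2Seq 2 μ)).norm.integrable_sq.integrableOn
    (Filter.Eventually.of_forall fun x => sq_nonneg _)

theorem inner_compression {K : Type*} [NormedAddCommGroup K] [InnerProductSpace ℂ K]
    [CompleteSpace H] [CompleteSpace K] (J : H →L[ℂ] K) (T : K →L[ℂ] K) (φ ψ : H) :
    ⟪φ, (ContinuousLinearMap.adjoint J).comp (T.comp J) ψ⟫_ℂ = ⟪J φ, T (J ψ)⟫_ℂ := by
  simp only [ContinuousLinearMap.comp_apply, ContinuousLinearMap.adjoint_inner_right]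

theorem norm_of_mem_fibre_one {v : L2Seq} (hv : v ∈ fibre 1) : ‖v‖ = ‖v 0‖ := by
  have h : v = lp.single 2 0 (v 0) := by
    ext k
    rcases k with _ | k
    · simp
    · have h1 := hv (k + 1) (by simp)
      simp [h1]
  rw [h, lp.norm_single (by norm_num)]
  simp

/-- In a one-dimensional fibre the zeroth coordinate of `J φ` carries the whole norm, so it serves
as `g φ`. -/
theorem IsRankOne.exists_sections [CompleteSpace H] {M : POVM Ω H} (h : IsRankOne M) :
    ∃ (ν : Measure Ω) (g : H → Ω → ℂ), (∀ φ, Measurable (g φ)) ∧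
      (∀ (a b : ℂ) (φ ψ : H), ∀ᵐ y ∂ν, g (a • φ + b • ψ) y = a * g φ y + b * g ψ y) ∧
      ∀ (φ : H) (Y : Set Ω), MeasurableSet Y →
        ENNReal.ofReal (⟪φ, M Y φ⟫_ℂ).re = ∫⁻ y in Y, ENNReal.ofReal (‖g φ y‖ ^ 2) ∂ν := by
  obtain ⟨ν, -, -, m, -, ⟨J, hJ⟩, hm⟩ := h
  refine ⟨ν, fun φ y => ((J φ : directIntegral ν m) : Lp L2Seq 2 ν) y 0, fun φ => ?_,
    fun a b φ ψ => ?_, fun φ Y hY => ?_⟩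
  · exact ((lp.evalCLM ℂ (fun _ : ℕ => ℂ) 2 0).continuous.comp_stronglyMeasurable
      (Lp.stronglyMeasurable _)).measurable
  · have h1 : ((J (a • φ + b • ψ) : directIntegral ν m) : Lp L2Seq 2 ν)
        = a • ((J φ : directIntegral ν m) : Lp L2Seq 2 ν)
          + b • ((J ψ : directIntegral ν m) : Lp L2Seq 2 ν) := by
      rw [map_add, map_smul, map_smul]
      rfl
    filter_upwards [Lp.coeFn_add (a • ((J φ : directIntegral ν m) : Lp L2Seq 2 ν))
      (b • ((J ψ : directIntegral ν m) : Lp L2Seq 2 ν)),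
      Lp.coeFn_smul a ((J φ : directIntegral ν m) : Lp L2Seq 2 ν),
      Lp.coeFn_smul b ((J ψ : directIntegral ν m) : Lp L2Seq 2 ν)] with y h2 h3 h4
    rw [h1, h2, Pi.add_apply, h3, h4]
    rfl
  · have h1 : ⟪φ, M Y φ⟫_ℂ = ⟪J φ, canonicalPVM ν m Y hY (J φ)⟫_ℂ := by
      rw [hJ.eq_compression Y hY]
      exact inner_compression J.toContinuousLinearMap (canonicalPVM ν m Y hY) φ φ
    rw [h1, inner_canonicalPVM_self_re]
    refine lintegral_congr_ae (ae_restrict_of_ae ?_)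
    filter_upwards [hm, (J φ).2] with y h2 h3
    rw [h2] at h3
    rw [norm_of_mem_fibre_one h3]

/-- Off one null set the quadratic form is nonnegative at a countable dense set of coefficients,
hence at all of them by continuity. -/
theorem POVM.IsDensity.norm_sq_le {M : POVM Ω H} {μ : Measure Ω} {k : H → H → Ω → ℂ}
    (hk : M.IsDensity μ k) (φ ψ : H) :
    ∀ᵐ x ∂μ, ‖k φ ψ x‖ ^ 2 ≤ (k φ φ x).re * (k ψ ψ x).re := by
  have h1 : ∀ᵐ x ∂μ, ∀ n, 0 ≤ ‖(TopologicalSpace.denseSeq (ℂ × ℂ) n).1‖ ^ 2 * (k φ φ x).re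
      + 2 * (starRingEnd ℂ (TopologicalSpace.denseSeq (ℂ × ℂ) n).1
        * (TopologicalSpace.denseSeq (ℂ × ℂ) n).2 * k φ ψ x).re
      + ‖(TopologicalSpace.denseSeq (ℂ × ℂ) n).2‖ ^ 2 * (k ψ ψ x).re := by
    refine ae_all_iff.2 fun n => ?_
    filter_upwards [hk.re_comb (TopologicalSpace.denseSeq (ℂ × ℂ) n).1
      (TopologicalSpace.denseSeq (ℂ × ℂ) n).2 φ ψ, hk.re_nonneg _] with x h2 h3
    exact h3.trans_eq h2
  filter_upwards [h1] with x hx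
  refine norm_sq_le_of_quadratic_nonneg _ _ _ fun a b => ?_
  have hcl : IsClosed {u : ℂ × ℂ | 0 ≤ ‖u.1‖ ^ 2 * (k φ φ x).re
      + 2 * (starRingEnd ℂ u.1 * u.2 * k φ ψ x).re + ‖u.2‖ ^ 2 * (k ψ ψ x).re} := by
    refine isClosed_le continuous_const ?_
    have := Complex.continuous_conj
    have := Complex.continuous_re
    fun_prop
  exact hcl.closure_subset_iff.2 (range_subset_iff.2 hx)
    (TopologicalSpace.denseRange_denseSeq (ℂ × ℂ) (a, b))

end

/-! ### Partitions of the outcome space and vanishing minors -/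

variable {Ω₁ Ω₂ : Type*} [MeasurableSpace Ω₁] [MeasurableSpace Ω₂] {H : Type*}
  [NormedAddCommGroup H] [InnerProductSpace ℂ H]

theorem IsWeakMarkovKernel.hasSum_one {μ : Measure Ω₁} {β : Set Ω₂ → Ω₁ → ℝ}
    (hβ : IsWeakMarkovKernel μ β) {Y : ℕ → Set Ω₂} (hY : ∀ n, MeasurableSet (Y n))
    (hd : Pairwise (Function.onFun Disjoint Y)) (hU : ⋃ n, Y n = univ) :
    ∀ᵐ x ∂μ, HasSum (fun n => β (Y n) x) 1 := by
  filter_upwards [hβ.hasSum_iUnion Y hY hd, hβ.univ_eq_one] with x h1 h2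
  rwa [hU, h2] at h1

/-- An estimate for the densities of `M₁` through a countable partition of the outcome space
of a post-processing. -/
theorem lintegral_le_tsum_of_isWeakMarkovKernel {M₁ : POVM Ω₁ H} {M₂ : POVM Ω₂ H}
    {μ μ' : Measure Ω₁} {k : H → H → Ω₁ → ℂ} (hk : M₁.IsDensity μ k) (hμ : μ ≪ μ')
    {β : Set Ω₂ → Ω₁ → ℝ} (hβ : IsWeakMarkovKernel μ' β)
    (hM : ∀ Y, MeasurableSet Y → ∀ φ : H,
      ⟪φ, M₂ Y φ⟫_ℂ = ((∫ x, β Y x ∂(M₁.diagMeasure φ) : ℝ) : ℂ))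
    (hM₁ : M₁.AbsCont μ')
    {Y : ℕ → Set Ω₂} (hY : ∀ n, MeasurableSet (Y n))
    (hd : Pairwise (Function.onFun Disjoint Y)) (hU : ⋃ n, Y n = univ)
    {D : Ω₁ → ℝ≥0∞} (hD : AEMeasurable D μ) {χ : ℕ → H}
    (hDχ : ∀ n, ∀ᵐ x ∂μ, D x ≤ ENNReal.ofReal (k (χ n) (χ n) x).re) :
    ∫⁻ x, D x ∂μ ≤ ∑' n, ENNReal.ofReal (⟪χ n, M₂ (Y n) (χ n)⟫_ℂ).re := by
  have hsum := hβ.hasSum_one hY hd hU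
  have hnn : ∀ᵐ x ∂μ', ∀ n, 0 ≤ β (Y n) x := ae_all_iff.2 fun n => hβ.nonneg _ (hY n)
  have hβm : ∀ n, AEMeasurable (fun x => ENNReal.ofReal (β (Y n) x)) μ := fun n =>
    ((hβ.aemeasurable _ (hY n)).mono_ac hμ).ennreal_ofReal
  -- Insert `1 = ∑ β(Yₙ, x)`.
  have h1 : ∫⁻ x, D x ∂μ = ∫⁻ x, ∑' n, ENNReal.ofReal (β (Y n) x) * D x ∂μ := by
    refine lintegral_congr_ae ?_
    filter_upwards [hμ.ae_le hsum, hμ.ae_le hnn] with x hx hx0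
    rw [ENNReal.tsum_mul_right, ← ENNReal.ofReal_tsum_of_nonneg hx0 hx.summable, hx.tsum_eq]
    simp
  rw [h1, lintegral_tsum fun n => by exact (hβm n).mul hD]
  refine ENNReal.tsum_le_tsum fun n => ?_
  have hac := hM₁.diagMeasure (χ n)
  have h_int : Integrable (β (Y n)) (M₁.diagMeasure (χ n)) := by
    refine Integrable.of_bound
      ((hβ.aemeasurable _ (hY n)).mono_ac hac).aestronglyMeasurable 1 ?_
    filter_upwards [hac.ae_le hsum, hac.ae_le hnn] with x hx hx0
    rw [Real.norm_of_nonneg (hx0 n)]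
    exact le_hasSum hx n fun j _ => hx0 j
  rw [hM _ (hY n), Complex.ofReal_re,
    ofReal_integral_eq_lintegral_ofReal h_int (hac.ae_le (hβ.nonneg _ (hY n))),
    hk.diagMeasure_eq, lintegral_withDensity_eq_lintegral_mul₀ (by
      exact (Complex.measurable_re.comp (hk.measurable _ _)).ennreal_ofReal.aemeasurable) (hβm n)]
  refine lintegral_mono_ae ?_
  filter_upwards [hDχ n] with x hx
  rw [Pi.mul_apply, mul_comm]
  gcongr

/-- If a post-processing of `M₁` is of rank 1, then all `2 × 2` minors of the density of `M₁`
vanish. -/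
theorem POVM.IsDensity.norm_sq_eq [CompleteSpace H] {M₁ : POVM Ω₁ H} {M₂ : POVM Ω₂ H}
    {μ μ' : Measure Ω₁} {k : H → H → Ω₁ → ℂ} (hk : M₁.IsDensity μ k) (hμ : μ ≪ μ')
    {β : Set Ω₂ → Ω₁ → ℝ} (hβ : IsWeakMarkovKernel μ' β)
    (hM : ∀ Y, MeasurableSet Y → ∀ φ : H,
      ⟪φ, M₂ Y φ⟫_ℂ = ((∫ x, β Y x ∂(M₁.diagMeasure φ) : ℝ) : ℂ))
    (hM₁ : M₁.AbsCont μ') (hM₂ : IsRankOne M₂) (φ ψ : H) :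
    ∀ᵐ x ∂μ, ‖k φ ψ x‖ ^ 2 = (k φ φ x).re * (k ψ ψ x).re := by
  obtain ⟨ν, g, hgm, hgl, hg⟩ := hM₂.exists_sections
  obtain ⟨u, hu1, hu2⟩ := exists_unit_net
  -- Determinant over trace of the Gram matrix. Where the trace is `0` the quotient is `0` by
  -- convention, and `ENNReal.ofReal` truncates negative values.
  set D : Ω₁ → ℝ≥0∞ := fun x => ENNReal.ofReal
    (((k φ φ x).re * (k ψ ψ x).re - ‖k φ ψ x‖ ^ 2) / ((k φ φ x).re + (k ψ ψ x).re))
  have hDm : Measurable D := by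
    have := hk.measurable φ φ
    have := hk.measurable ψ ψ
    have := hk.measurable φ ψ
    fun_prop
  set C : ℝ≥0∞ := ∫⁻ y, ENNReal.ofReal (‖g φ y‖ ^ 2 + ‖g ψ y‖ ^ 2) ∂ν
  have hC : C ≠ ∞ := by
    have h1 := hg φ univ MeasurableSet.univ
    have h2 := hg ψ univ MeasurableSet.univ
    rw [Measure.restrict_univ] at h1 h2
    have h3 : C = ENNReal.ofReal (⟪φ, M₂ univ φ⟫_ℂ).re + ENNReal.ofReal (⟪ψ, M₂ univ ψ⟫_ℂ).re := by
      rw [h1, h2, ← lintegral_add_left (by have := hgm φ; fun_prop)]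
      exact lintegral_congr fun y => ENNReal.ofReal_add (by positivity) (by positivity)
    rw [h3]
    finiteness
  set χ : ℕ → H := fun n => (u n).1 • φ + (u n).2 • ψ
  have hDχ : ∀ n, ∀ᵐ x ∂μ, D x ≤ ENNReal.ofReal (k (χ n) (χ n) x).re := by
    intro n
    filter_upwards [hk.re_comb (u n).1 (u n).2 φ ψ, hk.re_nonneg φ, hk.re_nonneg ψ,
      hk.re_nonneg (χ n)] with x h1 h2 h3 h4
    refine ENNReal.ofReal_le_ofReal (div_le_of_le_mul₀ (add_nonneg h2 h3) h4 ?_)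
    rw [h1, mul_comm (_ + _ + _)]
    exact det_le_trace_mul _ _ _ _ _ (hu1 n)
  have hbound : ∀ ε > (0 : ℝ), ∫⁻ x, D x ∂μ ≤ ENNReal.ofReal ε * C := by
    intro ε hε
    -- The outcomes at which the section of `χ n` is small. The net property makes them cover `Ω₂`,
    -- and `disjointed` turns the cover into a partition.
    set Z : ℕ → Set Ω₂ := fun n => {y | ‖(u n).1 * g φ y + (u n).2 * g ψ y‖ ^ 2
      ≤ ε * (‖g φ y‖ ^ 2 + ‖g ψ y‖ ^ 2)}
    have hZ : ∀ n, MeasurableSet (Z n) := by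
      intro n
      have := hgm φ
      have := hgm ψ
      exact measurableSet_le (by fun_prop) (by fun_prop)
    have hY : ∀ n, MeasurableSet (disjointed Z n) := MeasurableSet.disjointed hZ
    have hU : ⋃ n, disjointed Z n = univ := by
      rw [iUnion_disjointed]
      exact eq_univ_of_forall fun y => mem_iUnion.2 (hu2 ε hε (g φ y) (g ψ y))
    refine (lintegral_le_tsum_of_isWeakMarkovKernel hk hμ hβ hM hM₁ hY (disjoint_disjointed Z) hU
      hDm.aemeasurable hDχ).trans ?_
    calc ∑' n, ENNReal.ofReal (⟪χ n, M₂ (disjointed Z n) (χ n)⟫_ℂ).re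
        ≤ ∑' n, ∫⁻ y in disjointed Z n,
            ENNReal.ofReal ε * ENNReal.ofReal (‖g φ y‖ ^ 2 + ‖g ψ y‖ ^ 2) ∂ν := by
          refine ENNReal.tsum_le_tsum fun n => ?_
          rw [hg _ _ (hY n)]
          refine lintegral_mono_ae ?_
          filter_upwards [ae_restrict_mem (hY n), ae_restrict_of_ae (hgl (u n).1 (u n).2 φ ψ)]
            with y h1 h2
          rw [h2, ← ENNReal.ofReal_mul hε.le]
          exact ENNReal.ofReal_le_ofReal (disjointed_subset Z n h1)
      _ = ENNReal.ofReal ε * C := by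
          rw [← lintegral_iUnion hY (disjoint_disjointed Z), hU, Measure.restrict_univ,
            lintegral_const_mul']
          finiteness
  have hzero : ∫⁻ x, D x ∂μ = 0 := by
    have h1 : Filter.Tendsto (fun ε : ℝ => ENNReal.ofReal ε * C) (nhdsWithin 0 (Ioi 0))
        (nhds 0) := by
      have h2 : Filter.Tendsto (fun ε : ℝ => ENNReal.ofReal ε) (nhdsWithin 0 (Ioi 0))
          (nhds 0) := by
        have h3 := (ENNReal.continuous_ofReal.tendsto 0).mono_left
          (nhdsWithin_le_nhds (s := Ioi 0))
        rwa [ENNReal.ofReal_zero] at h3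
      have h4 := ENNReal.Tendsto.mul_const h2 (Or.inr hC)
      rwa [zero_mul] at h4
    refine le_antisymm (ge_of_tendsto h1 ?_) zero_le
    filter_upwards [self_mem_nhdsWithin] with ε hε using hbound ε hε
  rw [lintegral_eq_zero_iff hDm] at hzero
  filter_upwards [hzero, hk.norm_sq_le φ ψ, hk.re_nonneg φ, hk.re_nonneg ψ] with x h1 h2 h3 h4
  refine le_antisymm h2 ?_
  -- At trace zero `D` carries no information, but there both diagonal entries vanish.
  rcases (add_nonneg h3 h4).eq_or_lt with h5 | h5
  · have h6 : (k φ φ x).re = 0 := by linarith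
    rw [h6, zero_mul]
    positivity
  · have h6 : ((k φ φ x).re * (k ψ ψ x).re - ‖k φ ψ x‖ ^ 2)
        / ((k φ φ x).re + (k ψ ψ x).re) ≤ 0 := ENNReal.ofReal_eq_zero.1 h1
    rw [div_le_iff₀ h5, zero_mul] at h6
    linarith

end


/-! ### Construction of a dilation with one-dimensional fibres -/

/-- The unit vector that spans the one-dimensional fibre. -/
def fibreVec : L2Seq := lp.single 2 0 1

theorem norm_fibreVec : ‖fibreVec‖ = 1 := by
  rw [fibreVec, lp.norm_single (by norm_num)]
  simp

theorem smul_fibreVec_mem (c : ℂ) : c • fibreVec ∈ fibre 1 := by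
  refine Submodule.smul_mem _ _ fun k hk => ?_
  have hk0 : k ≠ 0 := by
    rintro rfl
    simp at hk
  simp [fibreVec, hk0]

theorem eq_smul_fibreVec {v : L2Seq} (hv : v ∈ fibre 1) : v = v 0 • fibreVec := by
  ext k
  rcases k with _ | k
  · simp [fibreVec]
  · have h1 := hv (k + 1) (by simp)
    simp [h1, fibreVec]

variable {Ω : Type*} [MeasurableSpace Ω] {H : Type*} [NormedAddCommGroup H]
  [InnerProductSpace ℂ H]

/-- A measurable field of linear functionals `f · x` with `∫_X |f φ|² dμ = ⟨φ | M(X) φ⟩` that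
vanishes almost nowhere makes `M` an observable of rank 1. -/
theorem isRankOne_of_sections [CompleteSpace H] {M : POVM Ω H} {μ : Measure Ω} [SigmaFinite μ]
    (hM : M.AbsCont μ) (f : H → Ω → ℂ) (hfm : ∀ φ, Measurable (f φ))
    (hadd : ∀ φ ψ, ∀ᵐ x ∂μ, f (φ + ψ) x = f φ x + f ψ x)
    (hsmul : ∀ (c : ℂ) φ, ∀ᵐ x ∂μ, f (c • φ) x = c * f φ x)
    (h_int : ∀ φ, Integrable (fun x => ‖f φ x‖ ^ 2) μ)
    (hf : ∀ φ X, MeasurableSet X → ∫ x in X, ‖f φ x‖ ^ 2 ∂μ = (⟪φ, M X φ⟫_ℂ).re)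
    (φs : ℕ → H) (hne : ∀ᵐ x ∂μ, ∃ n, f (φs n) x ≠ 0) : IsRankOne M := by
  have hmem : ∀ φ, MemLp (fun x => f φ x • fibreVec) 2 μ := by
    intro φ
    have h1 : MemLp (f φ) 2 μ :=
      (memLp_two_iff_integrable_sq_norm (hfm φ).aestronglyMeasurable).2 (h_int φ)
    refine MemLp.of_le h1 ((hfm φ).stronglyMeasurable.smul_const _).aestronglyMeasurable
      (Filter.Eventually.of_forall fun x => ?_)
    rw [norm_smul, norm_fibreVec, mul_one]
  let m : Ω → ℕ∞ := fun _ => 1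
  let F : H → directIntegral μ m := fun φ => ⟨(hmem φ).toLp _, by
    change ∀ᵐ x ∂μ, _
    filter_upwards [(hmem φ).coeFn_toLp] with x hx
    rw [hx]
    exact smul_fibreVec_mem _⟩
  have hF : ∀ φ, ((F φ : directIntegral μ m) : Lp L2Seq 2 μ) =ᵐ[μ] fun x => f φ x • fibreVec :=
    fun φ => (hmem φ).coeFn_toLp
  have hFinner : ∀ φ X (hX : MeasurableSet X),
      ⟪F φ, canonicalPVM μ m X hX (F φ)⟫_ℂ = ⟪φ, M X φ⟫_ℂ := by
    intro φ X hX
    rw [inner_canonicalPVM, M.inner_right_eq_re hX, ← hf φ X hX, ← integral_complex_ofReal]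
    refine integral_congr_ae (ae_restrict_of_ae ?_)
    filter_upwards [hF φ] with x hx
    rw [hx, inner_self_eq_norm_sq_to_K, norm_smul, norm_fibreVec, mul_one]
    simp
  have hPuniv : ∀ η, canonicalPVM μ m univ MeasurableSet.univ η = η := by
    intro η
    refine Subtype.ext (Lp.ext ?_)
    filter_upwards [coeFn_indicatorLp μ univ MeasurableSet.univ (η : Lp L2Seq 2 μ)] with x hx
    refine hx.trans ?_
    rw [indicator_univ]
  let L : H →ₗ[ℂ] directIntegral μ m :=
    { toFun := F
      map_add' := by
        intro φ ψ
        refine Subtype.ext (Lp.ext ?_)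
        filter_upwards [hF (φ + ψ), hF φ, hF ψ, hadd φ ψ,
          Lp.coeFn_add (F φ : Lp L2Seq 2 μ) (F ψ : Lp L2Seq 2 μ)] with x h1 h2 h3 h4 h5
        rw [h1, h4, Submodule.coe_add, h5, Pi.add_apply, h2, h3, add_smul]
      map_smul' := by
        intro c φ
        refine Subtype.ext (Lp.ext ?_)
        filter_upwards [hF (c • φ), hF φ, hsmul c φ,
          Lp.coeFn_smul c (F φ : Lp L2Seq 2 μ)] with x h1 h2 h3 h4
        rw [h1, h3, RingHom.id_apply, Submodule.coe_smul, h4, Pi.smul_apply, h2, mul_smul] }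
  let J : H →ₗᵢ[ℂ] directIntegral μ m := ⟨L, by
    intro φ
    have h1 := hFinner φ univ MeasurableSet.univ
    rw [hPuniv, M.map_univ, ContinuousLinearMap.id_apply] at h1
    have h3 := (inner_self_eq_norm_sq_to_K (𝕜 := ℂ) (F φ)).symm.trans
      (h1.trans (inner_self_eq_norm_sq_to_K (𝕜 := ℂ) φ))
    have h2 : ‖F φ‖ ^ 2 = ‖φ‖ ^ 2 := by exact_mod_cast h3
    exact (sq_eq_sq₀ (norm_nonneg _) (norm_nonneg _)).1 h2⟩
  refine ⟨μ, inferInstance, hM, m, measurable_const, ⟨J, ?_, ?_⟩,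
    Filter.Eventually.of_forall fun _ => rfl⟩
  · intro X hX
    -- Over `ℂ` an operator is determined by its quadratic form, so `hFinner` suffices.
    refine ContinuousLinearMap.coe_inj.1 ((ext_inner_map _ _).1 fun φ => ?_)
    rw [← inner_conj_symm, ← inner_conj_symm (_ : H) φ]
    congr 1
    refine (hFinner φ X hX).symm.trans ?_
    exact (inner_compression J.toContinuousLinearMap (canonicalPVM μ m X hX) φ φ).symm
  · rw [Submodule.dense_iff_topologicalClosure_eq_top, Submodule.topologicalClosure_eq_top_iff,
      Submodule.eq_bot_iff]
    intro η hη
    -- Orthogonality to `P(X) J φₙ` for every `X` localizes to pointwise orthogonality. Since some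
    -- `f φₙ` is nonzero at almost every point, it spans the fibre there and `η` vanishes.
    have h1 : ∀ n, ∀ᵐ x ∂μ, ⟪(η : Lp L2Seq 2 μ) x, f (φs n) x • fibreVec⟫_ℂ = 0 := by
      intro n
      have hi : Integrable (fun x => ⟪(η : Lp L2Seq 2 μ) x,
          ((F (φs n) : directIntegral μ m) : Lp L2Seq 2 μ) x⟫_ℂ) μ :=
        L2.integrable_inner _ _
      have hspan : ∀ X (hX : MeasurableSet X), canonicalPVM μ m X hX (F (φs n)) ∈
          Submodule.span ℂ {η | ∃ (X : Set Ω) (hX : MeasurableSet X) (φ : H),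
            η = canonicalPVM μ m X hX (J φ)} :=
        fun X hX => Submodule.subset_span ⟨X, hX, φs n, rfl⟩
      have h2 := Integrable.ae_eq_zero_of_forall_setIntegral_eq_zero hi fun X hX _ =>
        (inner_canonicalPVM μ m X hX η (F (φs n))).symm.trans
          (Submodule.inner_left_of_mem_orthogonal (hspan X hX) hη)
      filter_upwards [h2, hF (φs n)] with x h3 h4
      rwa [h4] at h3
    refine Subtype.ext (Lp.ext ?_)
    filter_upwards [ae_all_iff.2 h1, hne, η.2, Lp.coeFn_zero L2Seq 2 μ] with x h2 ⟨n, h3⟩ h4 h5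
    refine Eq.trans ?_ h5.symm
    have h6 := h2 n
    have h7 := eq_smul_fibreVec h4
    rw [inner_smul_right, mul_eq_zero, or_iff_right h3, h7, inner_smul_left,
      inner_self_eq_norm_sq_to_K, norm_fibreVec] at h6
    rw [h7]
    have h8 : (η : Lp L2Seq 2 μ) x 0 = 0 := by simpa using h6
    rw [h8, zero_smul]
    rfl

namespace POVM.IsDensity

variable [TopologicalSpace.SeparableSpace H] {M : POVM Ω H} {k : H → H → Ω → ℂ}

/-- Each diagonal measure is concentrated where its own density is positive, and the reference
measure is absolutely continuous with respect to their sum. -/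
theorem exists_re_pos (hk : M.IsDensity M.refMeasure k) : ∀ᵐ x ∂M.refMeasure,
    ∃ n, 0 < (k (TopologicalSpace.denseSeq H n) (TopologicalSpace.denseSeq H n) x).re := by
  refine M.refMeasure_absolutelyContinuous_sum.ae_le (Measure.ae_sum_iff.2 fun n => ?_)
  rw [hk.diagMeasure_eq, ae_withDensity_iff
    (by exact (Complex.measurable_re.comp (hk.measurable _ _)).ennreal_ofReal)]
  refine Filter.Eventually.of_forall fun x hx => ⟨n, ?_⟩
  by_contra hc
  exact hx (ENNReal.ofReal_of_nonpos (not_lt.1 hc))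

/-- An observable whose density has vanishing `2 × 2` minors is of rank 1. -/
theorem isRankOne [CompleteSpace H] (hk : M.IsDensity M.refMeasure k)
    (h : ∀ φ ψ, ∀ᵐ x ∂M.refMeasure, ‖k φ ψ x‖ ^ 2 = (k φ φ x).re * (k ψ ψ x).re) :
    IsRankOne M := by
  classical
  set e : ℕ → H := TopologicalSpace.denseSeq H
  have hre : ∀ n, Measurable fun x => (k (e n) (e n) x).re := fun n =>
    Complex.measurable_re.comp (hk.measurable _ _)
  -- The second alternative makes the search for an index total; it matters only on the null set
  -- where no density is positive.
  let p : ℕ → Ω → Prop := fun n x =>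
    0 < (k (e n) (e n) x).re ∨ ∀ j, (k (e j) (e j) x).re ≤ 0
  have hp : ∀ x, ∃ n, p n x := by
    intro x
    by_cases hx : ∃ n, 0 < (k (e n) (e n) x).re
    · exact hx.imp fun n hn => Or.inl hn
    · push Not at hx
      exact ⟨0, Or.inr hx⟩
  have hpm : ∀ n, MeasurableSet {x | p n x} := by
    intro n
    have h1 : {x | p n x} = {x | 0 < (k (e n) (e n) x).re} ∪
        ⋂ j, {x | (k (e j) (e j) x).re ≤ 0} := by
      ext x
      simp [p]
    rw [h1]
    exact (measurableSet_lt measurable_const (hre n)).union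
      (MeasurableSet.iInter fun j => measurableSet_le (hre j) measurable_const)
  let N : Ω → ℕ := fun x => Nat.find (hp x)
  have hN : ∀ᵐ x ∂M.refMeasure, 0 < (k (e (N x)) (e (N x)) x).re := by
    filter_upwards [hk.exists_re_pos] with x ⟨n, hn⟩
    rcases Nat.find_spec (hp x) with h1 | h1
    · exact h1
    · exact absurd (h1 n) (not_le.2 hn)
  -- The normalized row of the form at `e (N x)`. The index does not depend on `φ`, so `f` inherits
  -- linearity, and the vanishing minors give `|f φ|² = k φ φ`.
  let f : H → Ω → ℂ := fun φ x => k (e (N x)) φ x / (Real.sqrt (k (e (N x)) (e (N x)) x).re : ℂ)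
  have hsq : ∀ φ, ∀ᵐ x ∂M.refMeasure, ‖f φ x‖ ^ 2 = (k φ φ x).re := by
    intro φ
    filter_upwards [hN, ae_all_iff.2 fun n => h (e n) φ] with x h1 h2
    rw [norm_div, div_pow, h2, Complex.norm_real, Real.norm_eq_abs, sq_abs, Real.sq_sqrt h1.le]
    field_simp
  refine isRankOne_of_sections M.absCont_refMeasure f ?_ ?_ ?_ ?_ ?_ e ?_
  · intro φ
    exact Measurable.find (f := fun n x => k (e n) φ x / (Real.sqrt (k (e n) (e n) x).re : ℂ))
      (fun n => (hk.measurable _ _).div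
        (Complex.measurable_ofReal.comp (hre n).sqrt)) hpm hp
  · intro φ ψ
    filter_upwards [ae_all_iff.2 fun n => hk.add_right (e n) φ ψ] with x hx
    simp only [f, hx, add_div]
  · intro c φ
    filter_upwards [ae_all_iff.2 fun n => hk.smul_right c (e n) φ] with x hx
    simp only [f, hx, mul_div_assoc]
  · intro φ
    exact (hk.integrable φ φ).re.congr ((hsq φ).mono fun x hx => hx.symm)
  · intro φ X hX
    rw [← hk.setIntegral_re φ hX]
    exact integral_congr_ae (ae_restrict_of_ae (hsq φ))
  · filter_upwards [hN, ae_all_iff.2 fun n => hsq (e n)] with x h1 h2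
    refine ⟨N x, fun h0 => ?_⟩
    have h3 := h2 (N x)
    rw [h0] at h3
    simp at h3
    linarith

end POVM.IsDensity

end RankOnePOVM

end

theorem mainTheorem3 {Ω₁ Ω₂ : Type*} [MeasurableSpace Ω₁] [MeasurableSpace Ω₂]
    {H : Type*} [NormedAddCommGroup H] [InnerProductSpace ℂ H] [CompleteSpace H]
    [TopologicalSpace.SeparableSpace H]
    (hΩ₁ : RankOnePOVM.IsNice Ω₁) (hΩ₂ : MeasurableSpace.CountablyGenerated Ω₂)
    (M₁ : RankOnePOVM.POVM Ω₁ H) (M₂ : RankOnePOVM.POVM Ω₂ H)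
    (hM₂ : RankOnePOVM.IsRankOne M₂)
    (hpost : RankOnePOVM.IsPostProcessing M₂ M₁) :
    RankOnePOVM.IsRankOne M₁ := by
  obtain ⟨μ', -, hM₁, β, hβ, hM⟩ := hpost
  -- The reference measure replaces `μ'`, which may charge sets that `M₁` does not see and on which
  -- every fibre would be zero. Since it is absolutely continuous with respect to `μ'`, the almost
  -- everywhere properties of the kernel persist.
  obtain ⟨k, hk⟩ := M₁.exists_isDensity M₁.refMeasure M₁.absCont_refMeasure
  exact hk.isRankOne fun φ ψ =>
    hk.norm_sq_eq (M₁.refMeasure_absolutelyContinuous hM₁) hβ hM hM₁ hM₂ φ ψ
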